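/- Let $M$ be an oriented smooth Riemannian 3-manifold with Levi-Civita connection $\nabla$ and curvature $R(X,Y)Z=\nabla_X\nabla_YZ-\nabla_Y\nabla_XZ-\nabla_{[X,Y]}Z$. In an orthonormal frame put $R_{lkij}=\langle R(e_i,e_j)e_k,e_l\rangle$, $\mathrm{scal}=\sum_{a,b}R_{abab}$ and $\|R\|^2=\sum_{a,b,c,d}R_{abcd}^2$. Let $s>0$ and let $S_sM=\{u\in TM:\|u\|=s\}\to M$ be the tangent sphere bundle of radius $s$, with fibre $F_x=\{u\in T_xM:\|u\|=s\}$ over $x\in M$. On the fibre let $\alpha_2$ be the 2-form $(\alpha_2)_u(v,w)=\frac1s\,\mathrm{vol}_x(u,v,w)$, and orient the fibre so that $\alpha_2$ is positive. For a function $f$ on $S_sM$ put $$\check f(x)=\frac1{s^2}\int_{F_x}f\,\alpha_2 .$$ At each $u\in S_sM$ choose any adapted frame, that is, a positively oriented orthonormal frame $e_0,e_1,e_2$ of the tangent space of $M$ with $e_0=u/s$, and put $$c=R_{1212},\qquad r=R_{1010}+R_{2020},\qquad p^2=R_{1012}^2+R_{2012}^2,\qquad q^2=2R_{1002}^2+\tfrac12(R_{1001}-R_{2002})^2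 .$$ Then all the functions below are integrable over each fibre, and $$\check 1=4\pi,\qquad \check c=\frac{2\pi}{3}\,\mathrm{scal},\qquad (c^2)^\vee=\frac{\pi}{15}\bigl(2\|R\|^2+\mathrm{scal}^2\bigr),$$ $$\check r=\frac{4\pi}{3}\,\mathrm{scal},\qquad (r^2)^\vee=\frac{2\pi}{15}\bigl(\|R\|^2+3\,\mathrm{scal}^2\bigr),$$ $$(p^2)^\vee=\frac{\pi}{15}\bigl(3\|R\|^2-\mathrm{scal}^2\bigr),\qquad (q^2)^\vee=\frac{2\pi}{15}\bigl(3\|R\|^2-\mathrm{scal}^2\bigr).$$ -/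

import Mathlib

open Bundle MeasureTheory Metric
open scoped Manifold ContDiff Topology

noncomputable section

namespace TangentSphere

/-! ### Oriented Euclidean 3-spaces: adapted frames, surface measure, integrals of 2-forms -/

section Euclidean

variable {V : Type*} [NormedAddCommGroup V] [InnerProductSpace ℝ V]
  [Fact (Module.finrank ℝ V = 3)]

/-- `e = (e₀, e₁, e₂)` is adapted to `u`: it is a positively oriented orthonormal frame of the
oriented Euclidean 3-space `V` whose first vector is the direction of `u`. -/
structure IsAdapted (o : Orientation ℝ V (Fin 3)) (u : V) (e : Fin 3 → V) : Prop where
  orthonormal : Orthonormal ℝ e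
  zero_eq : e 0 = ‖u‖⁻¹ • u
  positive : 0 < o.volumeForm e

theorem exists_isAdapted (o : Orientation ℝ V (Fin 3)) {u : V} (hu : u ≠ 0) :
    ∃ e : Fin 3 → V, IsAdapted o u e := by
  have hfin : Module.finrank ℝ V = 3 := Fact.out
  have : FiniteDimensional ℝ V := FiniteDimensional.of_finrank_pos (by omega)
  have hn : ‖u‖ ≠ 0 := norm_ne_zero_iff.2 hu
  have hv : Orthonormal ℝ (({0} : Set (Fin 3)).domRestrict (fun _ : Fin 3 => ‖u‖⁻¹ • u)) := by
    refine ⟨fun i => ?_, fun i j hij => ?_⟩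
    · simp [Set.domRestrict, norm_smul, hn]
    · exact absurd (Subtype.ext (i.2.trans j.2.symm)) hij
  obtain ⟨b, hb⟩ := hv.exists_orthonormalBasis_extension_of_card_eq (by simp [hfin])
  have hb0 : b 0 = ‖u‖⁻¹ • u := hb 0 rfl
  have habs : |o.volumeForm b| = 1 := o.abs_volumeForm_apply_of_orthonormal b
  rcases lt_or_ge 0 (o.volumeForm b) with h | h
  · exact ⟨b, b.orthonormal, hb0, h⟩
  · refine ⟨b ∘ Equiv.swap 1 2, b.orthonormal.comp _ (Equiv.injective _), ?_, ?_⟩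
    · rw [Function.comp_apply, Equiv.swap_apply_of_ne_of_ne (by decide) (by decide), hb0]
    · rw [AlternatingMap.map_swap _ _ (by decide)]
      have h0 : o.volumeForm b ≠ 0 := fun h0 => by simp [h0] at habs
      have := lt_of_le_of_ne h h0
      linarith

/-- A choice of adapted frame at every `u ≠ 0`. -/
def adaptedFrame (o : Orientation ℝ V (Fin 3)) (u : V) : Fin 3 → V :=
  open Classical in if hu : u ≠ 0 then (exists_isAdapted o hu).choose else 0

theorem adaptedFrame_spec (o : Orientation ℝ V (Fin 3)) {u : V} (hu : u ≠ 0) :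
    IsAdapted o u (adaptedFrame o u) := by
  rw [adaptedFrame, dif_pos hu]
  exact (exists_isAdapted o hu).choose_spec

instance : FiniteDimensional ℝ V :=
  FiniteDimensional.of_finrank_pos (by rw [Fact.out (p := Module.finrank ℝ V = 3)]; norm_num)

/-- The 2-form `(1/s) u ⌟ vol` at the point `u` of `V`. -/
def alpha2 (o : Orientation ℝ V (Fin 3)) (s : ℝ) (u : V) : V [⋀^Fin 2]→ₗ[ℝ] ℝ :=
  s⁻¹ • o.volumeForm.curryLeft u

variable [MeasurableSpace V] [BorelSpace V]

variable (V) in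
/-- The area measure of the sphere of radius `s` about `0`, as a measure on `V`. -/
def sphereArea (s : ℝ) : Measure V :=
  ENNReal.ofReal (s ^ 2) •
    (volume : Measure V).toSphere.map (fun w : sphere (0 : V) 1 => s • (w : V))

/-- The density of a 2-form `β` along a sphere about `0` with respect to the area form: its value
on a positively oriented orthonormal basis `(e₁, e₂)` of the tangent plane `u^⊥`.  The sphere is
oriented by its outward normal `e₀`, that is, so that `α₂` is positive. -/
def sphereDensity (o : Orientation ℝ V (Fin 3)) (β : V → V [⋀^Fin 2]→ₗ[ℝ] ℝ) (u : V) : ℝ :=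
  β u ![adaptedFrame o u 1, adaptedFrame o u 2]

/-- The 2-form `β` is integrable over the sphere of radius `s` about `0`. -/
def SphereIntegrable (o : Orientation ℝ V (Fin 3)) (s : ℝ) (β : V → V [⋀^Fin 2]→ₗ[ℝ] ℝ) : Prop :=
  Integrable (sphereDensity o β) (sphereArea V s)

/-- The integral of the 2-form `β` over the oriented sphere of radius `s` about `0`. -/
def sphereIntegral (o : Orientation ℝ V (Fin 3)) (s : ℝ) (β : V → V [⋀^Fin 2]→ₗ[ℝ] ℝ) : ℝ :=
  ∫ u, sphereDensity o β u ∂(sphereArea V s)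

end Euclidean

/-! ### Oriented Riemannian 3-manifolds -/

/-- The model space of 3-manifolds. -/
abbrev E3 := EuclideanSpace ℝ (Fin 3)

section Manifold

variable {M : Type*} [TopologicalSpace M] [ChartedSpace E3 M]

instance (x : M) : MeasurableSpace (TangentSpace (𝓡 3) x) := borel _

instance (x : M) : Fact (Module.finrank ℝ (TangentSpace (𝓡 3) x) = 3) :=
  ⟨(finrank_euclideanSpace_fin : Module.finrank ℝ E3 = 3)⟩

variable [IsManifold (𝓡 3) ∞ M] [RiemannianBundle (fun x : M => TangentSpace (𝓡 3) x)]

instance (x : M) : BorelSpace (TangentSpace (𝓡 3) x) := ⟨rfl⟩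

variable (M) in
/-- An orientation of the Riemannian 3-manifold `M`: an orientation of every tangent space, which
is locally constant in the coordinates of the tangent bundle. -/
structure ManifoldOrientation where
  /-- The orientation of the tangent space at `x`. -/
  at' (x : M) : Orientation ℝ (TangentSpace (𝓡 3) x) (Fin 3)
  locally_constant (x : M) (v : Fin 3 → TangentSpace (𝓡 3) x) :
    0 < (at' x).volumeForm v →
      ∀ᶠ y in 𝓝 x, 0 < (at' y).volumeForm (fun i => FiberBundle.extend E3 (v i) y)

variable [IsContMDiffRiemannianBundle (𝓡 3) ∞ E3 (fun x : M => TangentSpace (𝓡 3) x)]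

instance : IsContMDiffRiemannianBundle (𝓡 3) 1 E3 (fun x : M => TangentSpace (𝓡 3) x) :=
  IsContMDiffRiemannianBundle.of_le (n := ∞) (by exact_mod_cast le_top)

/-- The connection `∇` is the Levi-Civita connection of the Riemannian manifold `M`: it takes
smooth vector fields to smooth tensor fields, preserves the metric, and has no torsion. -/
structure IsLeviCivita
    (cov : CovariantDerivative (𝓡 3) E3 (fun x : M => TangentSpace (𝓡 3) x)) : Prop where
  smooth : cov.ContMDiffCovariantDerivative ∞
  metric : cov.IsMetricCompatible
  torsion_free : cov.torsion = 0

variable (cov : CovariantDerivative (𝓡 3) E3 (fun x : M => TangentSpace (𝓡 3) x))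

/-- `R(X, Y) Z = ∇_X ∇_Y Z - ∇_Y ∇_X Z - ∇_{[X, Y]} Z` for vector fields `X`, `Y`, `Z`. -/
def curvatureField (X Y Z : Π x : M, TangentSpace (𝓡 3) x) (x : M) : TangentSpace (𝓡 3) x :=
  cov (fun y => cov Z y (Y y)) x (X x) - cov (fun y => cov Z y (X y)) x (Y x)
    - cov Z x (VectorField.mlieBracket (𝓡 3) X Y x)

/-- The curvature `R(v, w) z` on tangent vectors at `x`, computed with local extensions
of `v`, `w`, `z` to smooth vector fields near `x`. -/
def curvature {x : M} (v w z : TangentSpace (𝓡 3) x) : TangentSpace (𝓡 3) x :=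
  curvatureField cov (FiberBundle.extend E3 v) (FiberBundle.extend E3 w)
    (FiberBundle.extend E3 z) x

/-- The components `R_{lkij} = ⟨R(e_i, e_j) e_k, e_l⟩` in the frame `e` of the tangent space. -/
def Rm {x : M} (e : Fin 3 → TangentSpace (𝓡 3) x) (l k i j : Fin 3) : ℝ :=
  inner ℝ (curvature cov (e i) (e j) (e k)) (e l)

/-- The scalar curvature `∑ R_{abab}` in the orthonormal frame `e`. -/
def scal {x : M} (e : Fin 3 → TangentSpace (𝓡 3) x) : ℝ :=
  ∑ a, ∑ b, Rm cov e a b a b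

/-- The squared norm `‖R‖² = ∑ R_{abcd}²` in the orthonormal frame `e`. -/
def normSqR {x : M} (e : Fin 3 → TangentSpace (𝓡 3) x) : ℝ :=
  ∑ a, ∑ b, ∑ c, ∑ d, Rm cov e a b c d ^ 2

/-- The sectional curvature `c = R_{1212}` of the plane `u^⊥`, in a frame adapted to `u`. -/
def cFun {x : M} (e : Fin 3 → TangentSpace (𝓡 3) x) : ℝ :=
  Rm cov e 1 2 1 2

/-- `r = R_{1010} + R_{2020}`, the Ricci curvature of the direction `u`. -/
def rFun {x : M} (e : Fin 3 → TangentSpace (𝓡 3) x) : ℝ :=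
  Rm cov e 1 0 1 0 + Rm cov e 2 0 2 0

/-- `p² = R_{1012}² + R_{2012}²`. -/
def pSq {x : M} (e : Fin 3 → TangentSpace (𝓡 3) x) : ℝ :=
  Rm cov e 1 0 1 2 ^ 2 + Rm cov e 2 0 1 2 ^ 2

/-- `q² = 2 R_{1002}² + ½ (R_{1001} - R_{2002})²`. -/
def qSq {x : M} (e : Fin 3 → TangentSpace (𝓡 3) x) : ℝ :=
  2 * Rm cov e 1 0 0 2 ^ 2 + 1 / 2 * (Rm cov e 1 0 0 1 - Rm cov e 2 0 0 2) ^ 2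

/-- `f` can be integrated along the fibre at `x` of the tangent sphere bundle of radius `s`, and
`(1/s²) ∫_{π⁻¹(x)} f α₂ = a`.  Tangent vectors of the fibre are vertical, and on vertical vectors
`α₂ = (1/s) ξ ⌟ π^⋆vol` is the form `alpha2` of the tangent space. -/
def HasFibreIntegral (o : ManifoldOrientation M) (s : ℝ) (x : M)
    (f : TangentSpace (𝓡 3) x → ℝ) (a : ℝ) : Prop :=
  SphereIntegrable (o.at' x) s (fun u => f u • alpha2 (o.at' x) s u) ∧
    1 / s ^ 2 * sphereIntegral (o.at' x) s (fun u => f u • alpha2 (o.at' x) s u) = a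

end Manifold

end TangentSphere

end

/-! Everything happens in one tangent space. By `IsLeviCivita.isAlgebraicCurvature` the curvature at
`x` has the Riemannian symmetries, and in dimension three such a tensor is determined by its
symmetric Ricci operator `T` (`IsAlgebraicCurvature.exists_ricci`). Put `S = tr T` and `Q = tr T²`.
In a frame whose first vector is the unit vector `w`, `IsAlgebraicCurvature.components` gives `r =
⟨Tw,w⟩`, `c = S/2 - r`, `p² = |Tw|² - r²`, `q² = Q - 2|Tw|² + r² - (S - r)²/2` and `‖R‖² = 4Q - S²`.
So every integrand is a combination of `1`, `⟨Tw,w⟩`, `⟨Tw,w⟩²` and `|Tw|²`, whatever adapted frames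
are chosen. Since `α₂` restricts to the area form of the fibre, `sphereIntegral_smul_alpha2` reduces
the claim to the unit sphere. There `integral_symmetric_operator` diagonalises `T` and uses the
second and fourth moments of the coordinates, which follow from isometry invariance and the total
area `4π`. -/

noncomputable section

namespace TangentSphere

/-! ### Locally smooth vector fields and the Lie bracket. -/

section VectorFields

variable {E : Type*} [NormedAddCommGroup E] [NormedSpace ℝ E]
  {H : Type*} [TopologicalSpace H] {I : ModelWithCorners ℝ E H}
  {M : Type*} [TopologicalSpace M] [ChartedSpace H M]

theorem mvfderiv_congr {f g : M → ℝ} {x : M} (h : f =ᶠ[𝓝 x] g) : d% f x = d% g x := by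
  ext v
  exact congrArg (fun L : TangentSpace I x →L[ℝ] ℝ => L v) h.mfderiv_eq

/-- The vector field `X` is smooth in a neighbourhood of `x`. -/
def SmoothNear [IsManifold I 1 M] (X : Π x : M, TangentSpace I x) (x : M) : Prop :=
  ∀ᶠ y in 𝓝 x, CMDiffAt ∞ (T% X) y

variable [IsManifold I ∞ M] {X Y Z W : Π x : M, TangentSpace I x} {x : M}

theorem SmoothNear.contMDiffAt (hX : SmoothNear X x) : CMDiffAt ∞ (T% X) x :=
  hX.self_of_nhds

theorem SmoothNear.mdifferentiableAt (hX : SmoothNear X x) : MDiffAt (T% X) x :=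
  hX.contMDiffAt.mdifferentiableAt (by simp)

theorem SmoothNear.eventually (hX : SmoothNear X x) : ∀ᶠ y in 𝓝 x, SmoothNear X y :=
  eventually_eventually_nhds.2 hX

theorem SmoothNear.add (hX : SmoothNear X x) (hY : SmoothNear Y x) : SmoothNear (X + Y) x := by
  filter_upwards [hX, hY] with y h1 h2 using h1.add_section h2

theorem SmoothNear.sub (hX : SmoothNear X x) (hY : SmoothNear Y x) : SmoothNear (X - Y) x := by
  filter_upwards [hX, hY] with y h1 h2 using h1.sub_section h2

theorem SmoothNear.const_smul (a : ℝ) (hX : SmoothNear X x) : SmoothNear (a • X) x := by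
  filter_upwards [hX] with y h1 using h1.const_smul_section

theorem SmoothNear.smul {f : M → ℝ} (hf : ∀ᶠ y in 𝓝 x, CMDiffAt ∞ f y) (hX : SmoothNear X x) :
    SmoothNear (f • X) x := by
  filter_upwards [hf, hX] with y h1 h2 using h1.smul_section h2

theorem SmoothNear.mlieBracket [CompleteSpace E] (hX : SmoothNear X x) (hY : SmoothNear Y x) :
    SmoothNear (VectorField.mlieBracket I X Y) x := by
  filter_upwards [hX, hY] with y h1 h2
  have : IsManifold I (minSmoothness ℝ 2) M := by
    simpa using (inferInstance : IsManifold I 2 M)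
  have : IsManifold I (((⊤ : ℕ∞) : WithTop ℕ∞) + 1) M := by simpa using ‹IsManifold I ∞ M›
  exact ContMDiffAt.mlieBracket_vectorField (m := ⊤) (n := ⊤) h1 h2 (by simp)

theorem smoothNear_extend (v : TangentSpace I x) : SmoothNear (FiberBundle.extend E v) x := by
  obtain ⟨t, ht, h⟩ := FiberBundle.exists_contMDiffOn_extend (k := ∞) I E v
  filter_upwards [eventually_mem_nhds_iff.2 ht] with y hy using h.contMDiffAt hy

/-- Over the base set of the trivialization at `x` the extension is constant in coordinates, so it
is linear in `v` there. This makes the pointwise curvature trilinear without proving that it is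
tensorial. -/
theorem eventually_extend_eq (x : M) : ∀ᶠ y in 𝓝 x, ∀ v : TangentSpace I x,
    FiberBundle.extend E v y = (trivializationAt E (TangentSpace I) x).symmₗ ℝ y
      ((trivializationAt E (TangentSpace I) x).linearMapAt ℝ x v) := by
  have hx : x ∈ (trivializationAt E (TangentSpace I : M → _) x).baseSet :=
    FiberBundle.mem_baseSet_trivializationAt' x
  filter_upwards [(trivializationAt E (TangentSpace I) x).open_baseSet.mem_nhds hx] with y hy v
  rw [Trivialization.linearMapAt_apply, if_pos hx, FiberBundle.extend,
    Trivialization.coe_symmₗ _ hy]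

theorem extend_add (v w : TangentSpace I x) :
    ∀ᶠ y in 𝓝 x, FiberBundle.extend E (v + w) y
      = (FiberBundle.extend E v + FiberBundle.extend E w : Π y : M, TangentSpace I y) y := by
  filter_upwards [eventually_extend_eq (I := I) (E := E) x] with y hy
  simp only [Pi.add_apply, hy, map_add]

theorem extend_smul (a : ℝ) (v : TangentSpace I x) :
    ∀ᶠ y in 𝓝 x, FiberBundle.extend E (a • v) y
      = (a • FiberBundle.extend E v : Π y : M, TangentSpace I y) y := by
  filter_upwards [eventually_extend_eq (I := I) (E := E) x] with y hy
  simp only [Pi.smul_apply, hy, map_smul]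

/-- `[X, Y] f = X (Y f) - Y (X f)`. -/
theorem mvfderiv_mlieBracket [CompleteSpace E] [Nontrivial E] {f : M → ℝ}
    (hf : ∀ᶠ y in 𝓝 x, CMDiffAt ∞ f y) (hX : SmoothNear X x) (hY : SmoothNear Y x)
    (hXf : MDiffAt (fun y => d% f y (X y)) x) (hYf : MDiffAt (fun y => d% f y (Y y)) x) :
    d% f x (VectorField.mlieBracket I X Y x)
      = d% (fun y => d% f y (Y y)) x (X x) - d% (fun y => d% f y (X y)) x (Y x) := by
  -- Apply the Jacobi identity to `X`, `Y` and `f • W` with `W x ≠ 0`. After subtracting `f x` times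
  -- the identity for `W`, the terms with one derivative of `f` along `X` or `Y` cancel, and what
  -- remains is the claimed difference times `W x`.
  obtain ⟨w, hw⟩ := exists_ne (0 : E)
  let w' : TangentSpace I x := w
  let W : Π x : M, TangentSpace I x := FiberBundle.extend E w'
  have hW : SmoothNear W x := smoothNear_extend _
  have hWx : W x ≠ 0 := by
    rw [show W x = w' from FiberBundle.extend_apply_self E w']
    exact hw
  have hf1 : ∀ᶠ y in 𝓝 x, MDiffAt f y := hf.mono fun y hy => hy.mdifferentiableAt (by simp)
  have hbr (U : Π x : M, TangentSpace I x) :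
      VectorField.mlieBracket I U (f • W) =ᶠ[𝓝 x]
        (fun y => d% f y (U y)) • W + f • VectorField.mlieBracket I U W := by
    filter_upwards [hf1, hW.eventually] with y h1 h2
    exact VectorField.mlieBracket_smul_right h1 h2.mdifferentiableAt
  have hbr2 (U U' : Π x : M, TangentSpace I x) (hU : SmoothNear U x)
      (hUf : MDiffAt (fun y => d% f y (U y)) x) :
      VectorField.mlieBracket I U' (VectorField.mlieBracket I U (f • W)) x
        = d% (fun y => d% f y (U y)) x (U' x) • W x + d% f x (U x) • VectorField.mlieBracket I U' W x
          + (d% f x (U' x) • VectorField.mlieBracket I U W x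
            + f x • VectorField.mlieBracket I U' (VectorField.mlieBracket I U W) x) := by
    have hUW := (hU.mlieBracket hW).mdifferentiableAt
    have hcongr := Filter.EventuallyEq.mlieBracket_vectorField_eq (I := I)
      (Filter.EventuallyEq.refl (𝓝 x) U') (hbr U)
    rw [hcongr,
      VectorField.mlieBracket_add_right (hUf.smul_section hW.mdifferentiableAt)
        (hf1.self_of_nhds.smul_section hUW),
      VectorField.mlieBracket_smul_right hUf hW.mdifferentiableAt,
      VectorField.mlieBracket_smul_right hf1.self_of_nhds hUW]
  have : IsManifold I (minSmoothness ℝ 3) M := by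
    simpa using (inferInstance : IsManifold I 3 M)
  have hs {U : Π x : M, TangentSpace I x} (hU : SmoothNear U x) :
      CMDiffAt (minSmoothness ℝ 2) (T% U) x :=
    hU.contMDiffAt.of_le (by
      simpa using (by exact_mod_cast le_top : ((2 : ℕ∞) : WithTop ℕ∞) ≤ ((⊤ : ℕ∞) : WithTop ℕ∞)))
  have hJ := VectorField.leibniz_identity_mlieBracket_apply (hs hX) (hs hY) (hs (hW.smul hf))
  have hJW := VectorField.leibniz_identity_mlieBracket_apply (hs hX) (hs hY) (hs hW)
  rw [hbr2 Y X hY hYf, hbr2 X Y hX hXf, (hbr _).self_of_nhds] at hJ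
  simp only [Pi.add_apply, Pi.smul_apply', hJW] at hJ
  have h0 : (d% f x (VectorField.mlieBracket I X Y x)
      - (d% (fun y => d% f y (Y y)) x (X x) - d% (fun y => d% f y (X y)) x (Y x))) • W x = 0 := by
    rw [sub_smul, sub_smul, sub_eq_zero]
    rw [← sub_eq_zero] at hJ ⊢
    rw [← neg_eq_zero, ← hJ]
    module
  exact sub_eq_zero.1 ((smul_eq_zero.1 h0).resolve_right hWx)

end VectorFields

/-! ### Covariant derivatives of locally smooth fields. -/

section Connection

variable {E : Type*} [NormedAddCommGroup E] [NormedSpace ℝ E]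
  {H : Type*} [TopologicalSpace H] {I : ModelWithCorners ℝ E H}
  {M : Type*} [TopologicalSpace M] [ChartedSpace H M] [IsManifold I ∞ M]

/-- The vector field `∇_X Z`. -/
def nabla (cov : CovariantDerivative I E (fun x : M => TangentSpace I x))
    (X Z : Π x : M, TangentSpace I x) (x : M) : TangentSpace I x :=
  cov Z x (X x)

/-- The vector field `R(X, Y) Z`. -/
def curv (cov : CovariantDerivative I E (fun x : M => TangentSpace I x))
    (X Y Z : Π x : M, TangentSpace I x) (x : M) : TangentSpace I x :=
  nabla cov X (nabla cov Y Z) x - nabla cov Y (nabla cov X Z) x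
    - nabla cov (VectorField.mlieBracket I X Y) Z x

variable {cov : CovariantDerivative I E (fun x : M => TangentSpace I x)}
  {X X' Y Z Z' : Π x : M, TangentSpace I x} {x : M}

theorem SmoothNear.congr (hX : SmoothNear X x) (h : ∀ᶠ y in 𝓝 x, X y = X' y) : SmoothNear X' x := by
  filter_upwards [hX, eventually_eventually_nhds.2 h] with y h1 h2
  refine h1.congr_of_eventuallyEq ?_
  filter_upwards [h2] with z hz
  rw [hz]

/-- A connection is local. Equality is kept on a neighbourhood, not only at `x`, so that the lemma
can be iterated for second derivatives. -/
theorem nabla_congr (hZ : SmoothNear Z x) (hXX' : ∀ᶠ y in 𝓝 x, X y = X' y)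
    (hZZ' : ∀ᶠ y in 𝓝 x, Z y = Z' y) :
    ∀ᶠ y in 𝓝 x, nabla cov X Z y = nabla cov X' Z' y := by
  filter_upwards [hZ.eventually, (hZ.congr hZZ').eventually, hXX',
    eventually_eventually_nhds.2 hZZ'] with y h1 h2 h3 h4
  rw [nabla, nabla, h3, cov.isCovariantDerivativeOn.congr_of_eventuallyEq h1.mdifferentiableAt
    h2.mdifferentiableAt Filter.univ_mem h4]

theorem nabla_add_right (hZ : SmoothNear Z x) (hZ' : SmoothNear Z' x) :
    ∀ᶠ y in 𝓝 x, nabla cov X (Z + Z') y = (nabla cov X Z + nabla cov X Z') y := by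
  filter_upwards [hZ.eventually, hZ'.eventually] with y h1 h2
  rw [nabla, cov.isCovariantDerivativeOn.add (s := Set.univ) h1.mdifferentiableAt
    h2.mdifferentiableAt]
  rfl

theorem nabla_smul_right (a : ℝ) (hZ : SmoothNear Z x) :
    ∀ᶠ y in 𝓝 x, nabla cov X (a • Z) y = (a • nabla cov X Z) y := by
  filter_upwards [hZ.eventually] with y h1
  rw [nabla, cov.isCovariantDerivativeOn.smul_const (s := Set.univ) a h1.mdifferentiableAt]
  rfl

theorem nabla_sub_right (hZ : SmoothNear Z x) (hZ' : SmoothNear Z' x) :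
    ∀ᶠ y in 𝓝 x, nabla cov X (Z - Z') y = (nabla cov X Z - nabla cov X Z') y := by
  have h : Z - Z' = Z + (-1 : ℝ) • Z' := by
    rw [neg_smul, one_smul, sub_eq_add_neg]
  rw [h]
  filter_upwards [nabla_add_right (cov := cov) (X := X) hZ (hZ'.const_smul (-1)),
    nabla_smul_right (cov := cov) (X := X) (-1) hZ'] with y h1 h2
  rw [h1, Pi.add_apply, h2, Pi.sub_apply, Pi.smul_apply, neg_smul, one_smul, sub_eq_add_neg]

theorem nabla_add_left : nabla cov (X + X') Z = nabla cov X Z + nabla cov X' Z := by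
  ext1 y
  exact map_add _ _ _

theorem nabla_smul_left (a : ℝ) : nabla cov (a • X) Z = a • nabla cov X Z := by
  ext1 y
  exact map_smul _ _ _

/-- Smoothness of the connection is applied to globally smooth fields, so `Z` is first cut off by a
bump function that equals 1 near `x` and is supported where `Z` is smooth. -/
theorem SmoothNear.nabla [FiniteDimensional ℝ E] [T2Space M] (hcov : cov.ContMDiffCovariantDerivative ∞)
    (hX : SmoothNear X x) (hZ : SmoothNear Z x) : SmoothNear (nabla cov X Z) x := by
  obtain ⟨U, hU, hUo, hxU⟩ := eventually_nhds_iff.1 hZ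
  obtain ⟨f, -, hf⟩ := (SmoothBumpFunction.nhds_basis_tsupport (I := I) x).mem_iff.1
    (hUo.mem_nhds hxU)
  have hfZ : CMDiff ∞ (T% ((f : M → ℝ) • Z)) :=
    ContMDiffOn.smul_section_of_tsupport f.contMDiff.contMDiffOn hUo hf
      fun y hy => (hU y hy).contMDiffWithinAt
  have hcovZ := hcov.contMDiff.contMDiff hfZ.contMDiffOn
  have hZ' : ∀ᶠ y in 𝓝 x, Z y = ((f : M → ℝ) • Z) y := by
    filter_upwards [f.eventuallyEq_one] with y hy
    rw [Pi.smul_apply', hy, Pi.one_apply, one_smul]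
  have hsm : SmoothNear (TangentSphere.nabla cov X ((f : M → ℝ) • Z)) x := by
    filter_upwards [hX] with y hy
    exact ContMDiffAt.clm_bundle_apply (hcovZ.contMDiffAt Filter.univ_mem) hy
  exact hsm.congr ((nabla_congr hZ (.of_forall fun _ => rfl) hZ').mono fun _ h => h.symm)

theorem curv_swap : curv cov X Y Z x = -curv cov Y X Z x := by
  simp only [curv, nabla, VectorField.mlieBracket_swap_apply (V := X), map_neg]
  abel

end Connection

/-! ### Linearity of the curvature and the first Bianchi identity. -/

section CurvatureIdentities

variable {E : Type*} [NormedAddCommGroup E] [NormedSpace ℝ E] [FiniteDimensional ℝ E]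
  {H : Type*} [TopologicalSpace H] {I : ModelWithCorners ℝ E H}
  {M : Type*} [TopologicalSpace M] [ChartedSpace H M] [IsManifold I ∞ M] [T2Space M]
  {cov : CovariantDerivative I E (fun x : M => TangentSpace I x)}
  {X X' Y Z Z' : Π x : M, TangentSpace I x} {x : M}

theorem curv_congr (hcov : cov.ContMDiffCovariantDerivative ∞) (hX : SmoothNear X x)
    (hY : SmoothNear Y x) (hZ : SmoothNear Z x)
    {Y' : Π x : M, TangentSpace I x} (hXX' : ∀ᶠ y in 𝓝 x, X y = X' y)
    (hYY' : ∀ᶠ y in 𝓝 x, Y y = Y' y) (hZZ' : ∀ᶠ y in 𝓝 x, Z y = Z' y) :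
    curv cov X Y Z x = curv cov X' Y' Z' x := by
  have h1 := nabla_congr (cov := cov) (SmoothNear.nabla hcov hY hZ) hXX'
    (nabla_congr hZ hYY' hZZ')
  have h2 := nabla_congr (cov := cov) (SmoothNear.nabla hcov hX hZ) hYY'
    (nabla_congr hZ hXX' hZZ')
  have h3 : ∀ᶠ y in 𝓝 x, VectorField.mlieBracket I X Y y = VectorField.mlieBracket I X' Y' y := by
    filter_upwards [eventually_eventually_nhds.2 hXX', eventually_eventually_nhds.2 hYY']
      with y h h'
    exact Filter.EventuallyEq.mlieBracket_vectorField_eq h h'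
  have h4 := nabla_congr (cov := cov) hZ h3 hZZ'
  rw [curv, curv, h1.self_of_nhds, h2.self_of_nhds, h4.self_of_nhds]

theorem curv_add_left (hcov : cov.ContMDiffCovariantDerivative ∞) (hX : SmoothNear X x)
    (hX' : SmoothNear X' x) (hZ : SmoothNear Z x) :
    curv cov (X + X') Y Z x = curv cov X Y Z x + curv cov X' Y Z x := by
  have hbr : VectorField.mlieBracket I (X + X') Y x
      = VectorField.mlieBracket I X Y x + VectorField.mlieBracket I X' Y x :=
    VectorField.mlieBracket_add_left hX.mdifferentiableAt hX'.mdifferentiableAt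
  have h := (nabla_add_right (cov := cov) (X := Y) (SmoothNear.nabla hcov hX hZ)
    (SmoothNear.nabla hcov hX' hZ)).self_of_nhds
  rw [curv, nabla_add_left, nabla_add_left, h]
  simp only [curv, Pi.add_apply]
  rw [nabla.eq_def cov (VectorField.mlieBracket I (X + X') Y), hbr, map_add]
  simp only [nabla]
  abel

theorem curv_smul_left (hcov : cov.ContMDiffCovariantDerivative ∞) (a : ℝ) (hX : SmoothNear X x)
    (hZ : SmoothNear Z x) :
    curv cov (a • X) Y Z x = a • curv cov X Y Z x := by
  have hbr : VectorField.mlieBracket I (a • X) Y x = a • VectorField.mlieBracket I X Y x :=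
    VectorField.mlieBracket_const_smul_left hX.mdifferentiableAt
  have h := (nabla_smul_right (cov := cov) (X := Y) a (SmoothNear.nabla hcov hX hZ)).self_of_nhds
  rw [curv, nabla_smul_left, nabla_smul_left, h]
  simp only [curv, Pi.smul_apply]
  rw [nabla.eq_def cov (VectorField.mlieBracket I (a • X) Y), hbr, map_smul]
  simp only [nabla, smul_sub]

theorem curv_add_right (hcov : cov.ContMDiffCovariantDerivative ∞) (hX : SmoothNear X x)
    (hY : SmoothNear Y x) (hZ : SmoothNear Z x) (hZ' : SmoothNear Z' x) :
    curv cov X Y (Z + Z') x = curv cov X Y Z x + curv cov X Y Z' x := by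
  have key {U U' : Π x : M, TangentSpace I x} (hU' : SmoothNear U' x) :
      nabla cov U (nabla cov U' (Z + Z')) x
        = nabla cov U (nabla cov U' Z) x + nabla cov U (nabla cov U' Z') x := by
    have h1 := nabla_add_right (cov := cov) (X := U') hZ hZ'
    have h2 := nabla_congr (cov := cov) (X := U) (SmoothNear.nabla hcov hU' (hZ.add hZ'))
      (.of_forall fun _ => rfl) h1
    rw [h2.self_of_nhds, (nabla_add_right (cov := cov) (X := U) (SmoothNear.nabla hcov hU' hZ)
      (SmoothNear.nabla hcov hU' hZ')).self_of_nhds]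
    rfl
  rw [curv, key hY, key hX, (nabla_add_right hZ hZ').self_of_nhds]
  simp only [curv, Pi.add_apply]
  abel

theorem curv_smul_right (hcov : cov.ContMDiffCovariantDerivative ∞) (a : ℝ) (hX : SmoothNear X x)
    (hY : SmoothNear Y x) (hZ : SmoothNear Z x) :
    curv cov X Y (a • Z) x = a • curv cov X Y Z x := by
  have key {U U' : Π x : M, TangentSpace I x} (hU' : SmoothNear U' x) :
      nabla cov U (nabla cov U' (a • Z)) x = a • nabla cov U (nabla cov U' Z) x := by
    have h1 := nabla_smul_right (cov := cov) (X := U') a hZ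
    have h2 := nabla_congr (cov := cov) (X := U) (SmoothNear.nabla hcov hU' (hZ.const_smul a))
      (.of_forall fun _ => rfl) h1
    rw [h2.self_of_nhds,
      (nabla_smul_right (cov := cov) (X := U) a (SmoothNear.nabla hcov hU' hZ)).self_of_nhds]
    rfl
  rw [curv, key hY, key hX, (nabla_smul_right a hZ).self_of_nhds]
  simp only [curv, Pi.smul_apply, smul_sub]

/-- The first Bianchi identity. -/
theorem curv_bianchi (hcov : cov.ContMDiffCovariantDerivative ∞) (htor : cov.torsion = 0)
    (hX : SmoothNear X x) (hY : SmoothNear Y x) (hZ : SmoothNear Z x) :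
    curv cov X Y Z x + curv cov Y Z X x + curv cov Z X Y x = 0 := by
  -- Vanishing torsion is used twice: it collects the second derivatives of the cyclic sum into
  -- terms `∇_U [A, B]`, then turns `∇_U [A, B] - ∇_[A,B] U` into `[U, [A, B]]`. The Jacobi identity
  -- finishes.
  have tor {A B : Π x : M, TangentSpace I x} (hA : SmoothNear A x) (hB : SmoothNear B x) :
      ∀ᶠ y in 𝓝 x, (nabla cov A B - nabla cov B A) y = VectorField.mlieBracket I A B y := by
    filter_upwards [hA.eventually, hB.eventually] with y h1 h2
    exact cov.torsion_eq_zero_iff.1 htor h1.mdifferentiableAt h2.mdifferentiableAt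
  have key {U A B : Π x : M, TangentSpace I x} (hA : SmoothNear A x) (hB : SmoothNear B x) :
      nabla cov U (nabla cov A B) x - nabla cov U (nabla cov B A) x
        = nabla cov U (VectorField.mlieBracket I A B) x := by
    have hAB := SmoothNear.nabla hcov hA hB
    have hBA := SmoothNear.nabla hcov hB hA
    rw [← (nabla_congr (cov := cov) (X := U) (hAB.sub hBA) (.of_forall fun _ => rfl)
      (tor hA hB)).self_of_nhds, (nabla_sub_right hAB hBA).self_of_nhds, Pi.sub_apply]
  have : IsManifold I (minSmoothness ℝ 3) M := by
    simpa using (inferInstance : IsManifold I 3 M)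
  have hs {U : Π x : M, TangentSpace I x} (hU : SmoothNear U x) :
      CMDiffAt (minSmoothness ℝ 2) (T% U) x :=
    hU.contMDiffAt.of_le (by
      simpa using (by exact_mod_cast le_top : ((2 : ℕ∞) : WithTop ℕ∞) ≤ ((⊤ : ℕ∞) : WithTop ℕ∞)))
  have hJ := VectorField.leibniz_identity_mlieBracket_apply (hs hX) (hs hY) (hs hZ)
  have hswap : nabla cov (VectorField.mlieBracket I Z X) Y x
      = -nabla cov (VectorField.mlieBracket I X Z) Y x := by
    rw [nabla, VectorField.mlieBracket_swap_apply, map_neg]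
    rfl
  have h1 := key (U := X) hY hZ
  have h2 := key (U := Y) hX hZ
  have h3 := key (U := Z) hX hY
  have t1 := (tor hX (hY.mlieBracket hZ)).self_of_nhds
  have t2 := (tor hY (hX.mlieBracket hZ)).self_of_nhds
  have t3 := (tor hZ (hX.mlieBracket hY)).self_of_nhds
  rw [VectorField.mlieBracket_swap_apply (V := Z)] at t3
  simp only [Pi.sub_apply] at t1 t2 t3
  rw [← t1, ← t2, ← neg_eq_iff_eq_neg.2 t3, ← h1, ← h2, ← h3] at hJ
  rw [← sub_eq_zero] at hJ
  rw [curv, curv, curv, hswap, ← hJ]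
  abel

end CurvatureIdentities

/-! ### Skew-symmetry of the curvature of a metric connection. -/

section Metric

variable {M : Type*} [TopologicalSpace M] [ChartedSpace E3 M]
  [IsManifold (𝓡 3) ∞ M] [T2Space M] [RiemannianBundle (fun x : M => TangentSpace (𝓡 3) x)]
  [IsContMDiffRiemannianBundle (𝓡 3) ∞ E3 (fun x : M => TangentSpace (𝓡 3) x)]
  {cov : CovariantDerivative (𝓡 3) E3 (fun x : M => TangentSpace (𝓡 3) x)}
  {X Y Z : Π x : M, TangentSpace (𝓡 3) x} {x : M}

/-- The curvature of a metric connection is skew-symmetric. -/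
theorem inner_curv_self
    (hcov : cov.ContMDiffCovariantDerivative ∞) (hmet : cov.IsMetricCompatible)
    (hX : SmoothNear X x) (hY : SmoothNear Y x) (hZ : SmoothNear Z x) :
    inner ℝ (curv cov X Y Z x) (Z x) = 0 := by
  have met {U A B : Π x : M, TangentSpace (𝓡 3) x} (hA : SmoothNear A x) (hB : SmoothNear B x) :
      ∀ᶠ y in 𝓝 x, mvfderiv (𝓡 3) (fun y => inner ℝ (A y) (B y)) y (U y)
        = inner ℝ (nabla cov U A y) (B y) + inner ℝ (A y) (nabla cov U B y) := by
    filter_upwards [hA.eventually, hB.eventually] with y h1 h2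
    exact hmet.mvfderiv_inner_eq U h1.mdifferentiableAt h2.mdifferentiableAt
  have hf : ∀ᶠ y in 𝓝 x, ContMDiffAt (𝓡 3) 𝓘(ℝ) ∞ (fun y => inner ℝ (Z y) (Z y)) y := by
    filter_upwards [hZ] with y hy using hy.inner_bundle hy
  have hd {U : Π x : M, TangentSpace (𝓡 3) x} (hU : SmoothNear U x) :
      MDifferentiableAt (𝓡 3) 𝓘(ℝ) (fun y => inner ℝ (nabla cov U Z y) (Z y)) x ∧
        MDifferentiableAt (𝓡 3) 𝓘(ℝ) (fun y => inner ℝ (Z y) (nabla cov U Z y)) x := by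
    have h := (SmoothNear.nabla hcov hU hZ).mdifferentiableAt
    exact ⟨h.inner_bundle hZ.mdifferentiableAt, hZ.mdifferentiableAt.inner_bundle h⟩
  have hdf {U : Π x : M, TangentSpace (𝓡 3) x} (hU : SmoothNear U x) :
      MDifferentiableAt (𝓡 3) 𝓘(ℝ) (fun y => mvfderiv (𝓡 3) (fun y => inner ℝ (Z y) (Z y)) y (U y)) x :=
    ((hd hU).1.add (hd hU).2).congr_of_eventuallyEq (met hZ hZ)
  -- The last term is symmetric in `U` and `A`, so it drops out of `X(Y|Z|²) - Y(X|Z|²) - [X,Y]|Z|²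
  -- = 0`, leaving `2⟨R(X,Y)Z, Z⟩ = 0`.
  have hdd {U A : Π x : M, TangentSpace (𝓡 3) x} (hU : SmoothNear U x) :
      mvfderiv (𝓡 3) (fun y => mvfderiv (𝓡 3) (fun y => inner ℝ (Z y) (Z y)) y (U y)) x (A x)
        = 2 * inner ℝ (nabla cov A (nabla cov U Z) x) (Z x)
          + 2 * inner ℝ (nabla cov U Z x) (nabla cov A Z x) := by
    have hUZ := SmoothNear.nabla hcov hU hZ
    rw [mvfderiv_congr (met hZ hZ), mvfderiv_fun_add (hd hU).1 (hd hU).2, _root_.add_apply,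
      (met hUZ hZ).self_of_nhds, (met hZ hUZ).self_of_nhds,
      real_inner_comm (nabla cov U Z x) (nabla cov A Z x),
      real_inner_comm (Z x) (nabla cov A (nabla cov U Z) x)]
    ring
  have hbr := mvfderiv_mlieBracket hf hX hY (hdf hX) (hdf hY)
  rw [hdd hX, hdd hY, (met hZ hZ).self_of_nhds, real_inner_comm _ (Z x),
    real_inner_comm (nabla cov X Z x)] at hbr
  rw [curv, inner_sub_left, inner_sub_left]
  linarith

end Metric

/-! ### Moments over the unit sphere. -/

open scoped Pointwise

theorem sum_inner_sq_mul_inner_sq {V : Type*} [NormedAddCommGroup V]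
    [InnerProductSpace ℝ V] (b : OrthonormalBasis (Fin 3) ℝ V) (w : sphere (0 : V) 1) :
    ∑ i, ∑ j, inner ℝ (b i) (w : V) ^ 2 * inner ℝ (b j) (w : V) ^ 2 = 1 := by
  have h : ∑ i, inner ℝ (b i) (w : V) ^ 2 = 1 := by
    have := b.sum_sq_norm_inner_right (w : V)
    simpa using this
  simp_rw [← Finset.mul_sum, ← Finset.sum_mul, h]
  norm_num

section Sphere

variable {V : Type*} [NormedAddCommGroup V] [InnerProductSpace ℝ V]
  [Fact (Module.finrank ℝ V = 3)] [MeasurableSpace V] [BorelSpace V]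

theorem integrable_toSphere {G : V → ℝ} (hG : Continuous G) :
    Integrable (fun w : sphere (0 : V) 1 => G w) (volume : Measure V).toSphere :=
  (hG.comp continuous_subtype_val).integrable_of_hasCompactSupport
    (HasCompactSupport.of_compactSpace _)

theorem toSphere_real_univ : (volume : Measure V).toSphere.real Set.univ = 4 * Real.pi := by
  have h3 : Module.finrank ℝ V = 3 := Fact.out
  have : Nontrivial V := Module.nontrivial_of_finrank_pos (R := ℝ) (by omega)
  rw [Measure.toSphere_real_apply_univ, h3, measureReal_def,
    InnerProductSpace.volume_ball_of_dim_odd (k := 1) (by omega)]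
  rw [ENNReal.toReal_mul, ENNReal.toReal_pow, ENNReal.toReal_ofReal zero_le_one,
    ENNReal.toReal_ofReal (by positivity), h3]
  norm_num [Nat.doubleFactorial]
  ring

/-- The surface measure of the unit sphere is invariant under linear isometries. -/
theorem integral_toSphere_comp_isometry (f : V ≃ₗᵢ[ℝ] V) {G : V → ℝ} (hG : Continuous G) :
    ∫ w : sphere (0 : V) 1, G (f w) ∂(volume : Measure V).toSphere
      = ∫ w : sphere (0 : V) 1, G w ∂(volume : Measure V).toSphere := by
  let g : sphere (0 : V) 1 → sphere (0 : V) 1 := fun w => ⟨f w, by simp⟩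
  have hg : Continuous g := by
    apply Continuous.subtype_mk
    exact f.continuous.comp continuous_subtype_val
  have hmap : (volume : Measure V).toSphere.map g = (volume : Measure V).toSphere := by
    ext t ht
    -- Surface measure is defined by the volume of the cone over a set; a linear isometry respects
    -- cones and preserves volume.
    have hset : Set.Ioo (0 : ℝ) 1 • ((↑) '' (g ⁻¹' t) : Set V)
        = f ⁻¹' (Set.Ioo (0 : ℝ) 1 • ((↑) '' t : Set V)) := by
      ext v
      simp only [Set.mem_smul, Set.mem_image, Set.mem_preimage]
      constructor
      · rintro ⟨a, ha, _, ⟨y, hy, rfl⟩, rfl⟩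
        exact ⟨a, ha, g y, ⟨g y, hy, rfl⟩, by simp [g]⟩
      · rintro ⟨a, ha, _, ⟨y, hy, rfl⟩, h⟩
        refine ⟨a, ha, f.symm y, ⟨⟨f.symm y, by simp⟩, ?_, rfl⟩, ?_⟩
        · simpa [g] using hy
        · rw [← map_smul, h, f.symm_apply_apply]
    rw [Measure.map_apply hg.measurable ht, Measure.toSphere_apply' _ (hg.measurable ht),
      Measure.toSphere_apply' _ ht, hset,
      f.measurePreserving.measure_preimage_emb f.toHomeomorph.measurableEmbedding]
  conv_rhs => rw [← hmap]
  rw [integral_map hg.aemeasurable]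
  exact (hG.comp continuous_subtype_val).aestronglyMeasurable

variable (V) in
theorem exists_integral_inner_pow_four :
    ∃ m : ℝ, ∀ a : V, ∫ w : sphere (0 : V) 1, inner ℝ a (w : V) ^ 4 ∂(volume : Measure V).toSphere
      = m * ‖a‖ ^ 4 := by
  have h3 : Module.finrank ℝ V = 3 := Fact.out
  have : Nontrivial V := Module.nontrivial_of_finrank_pos (R := ℝ) (by omega)
  obtain ⟨b, hb⟩ := exists_norm_eq V zero_le_one
  refine ⟨∫ w : sphere (0 : V) 1, inner ℝ b (w : V) ^ 4 ∂(volume : Measure V).toSphere,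
    fun a => ?_⟩
  have hnorm : ‖a‖ = ‖‖a‖ • b‖ := by simp [norm_smul, hb]
  -- The reflection exchanging `a` and `‖a‖ • b` reduces every `a` to the fixed unit vector `b`.
  let f := (ℝ ∙ (a - ‖a‖ • b))ᗮ.reflection
  have hf : f a = ‖a‖ • b := Submodule.reflection_sub hnorm
  have hinner (w : V) : inner ℝ a (f w) = ‖a‖ * inner ℝ b w := by
    rw [← real_inner_smul_left, ← hf, ← f.inner_map_map a, Submodule.reflection_reflection]
  rw [← integral_toSphere_comp_isometry f (G := fun w => inner ℝ a w ^ 4) (by fun_prop),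
    ← integral_mul_const]
  congr with w
  rw [hinner]
  ring

/-- Polarisation: `12 x²y² = (x + y)⁴ + (x - y)⁴ - 2x⁴ - 2y⁴`. -/
theorem integral_inner_sq_mul_inner_sq {m : ℝ}
    (hm : ∀ a : V, ∫ w : sphere (0 : V) 1, inner ℝ a (w : V) ^ 4 ∂(volume : Measure V).toSphere
      = m * ‖a‖ ^ 4) (a b : V) :
    ∫ w : sphere (0 : V) 1, inner ℝ a (w : V) ^ 2 * inner ℝ b (w : V) ^ 2
        ∂(volume : Measure V).toSphere
      = m / 3 * (‖a‖ ^ 2 * ‖b‖ ^ 2 + 2 * inner ℝ a b ^ 2) := by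
  have key : ∫ w : sphere (0 : V) 1, inner ℝ a (w : V) ^ 2 * inner ℝ b (w : V) ^ 2
        ∂(volume : Measure V).toSphere
      = ∫ w : sphere (0 : V) 1, (1 / 12 * inner ℝ (a + b) (w : V) ^ 4
          + 1 / 12 * inner ℝ (a - b) (w : V) ^ 4
          + (-1 / 6 * inner ℝ a (w : V) ^ 4 + -1 / 6 * inner ℝ b (w : V) ^ 4))
        ∂(volume : Measure V).toSphere := by
    congr with w
    rw [inner_add_left, inner_sub_left]
    ring
  have hi (c : ℝ) (v : V) : Integrable (fun w : sphere (0 : V) 1 => c * inner ℝ v (w : V) ^ 4)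
      (volume : Measure V).toSphere :=
    integrable_toSphere (G := fun w => c * inner ℝ v w ^ 4) (by fun_prop)
  rw [key, integral_add (by exact (hi _ _).add (hi _ _)) (by exact (hi _ _).add (hi _ _)),
    integral_add (hi _ _) (hi _ _), integral_add (hi _ _) (hi _ _)]
  simp only [integral_const_mul, hm]
  have h1 := norm_add_sq_real a b
  have h2 := norm_sub_sq_real a b
  rw [show ‖a + b‖ ^ 4 = (‖a + b‖ ^ 2) ^ 2 by ring, show ‖a - b‖ ^ 4 = (‖a - b‖ ^ 2) ^ 2 by ring,
    h1, h2]
  ring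

/-- The unknown constant `m` is found by summing over `i` and `j`: the integrands add up to `|w|⁴ =
1`, so `5m` is the area `4π`. -/
theorem integral_inner_sq_mul_inner_sq_basis (b : OrthonormalBasis (Fin 3) ℝ V) (i j : Fin 3) :
    ∫ w : sphere (0 : V) 1, inner ℝ (b i) (w : V) ^ 2 * inner ℝ (b j) (w : V) ^ 2
        ∂(volume : Measure V).toSphere
      = 4 * Real.pi / 15 * (1 + 2 * if i = j then 1 else 0) := by
  obtain ⟨m, hm⟩ := exists_integral_inner_pow_four V
  have hij (i j : Fin 3) := integral_inner_sq_mul_inner_sq hm (b i) (b j)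
  simp only [b.norm_eq_one, b.inner_eq_ite] at hij
  have hsum : ∑ i : Fin 3, ∑ j : Fin 3, m / 3 * (1 ^ 2 * 1 ^ 2 + 2 * (if i = j then (1 : ℝ) else 0) ^ 2)
      = 4 * Real.pi := by
    simp_rw [← hij]
    have hi (i j : Fin 3) : Integrable (fun w : sphere (0 : V) 1 =>
        inner ℝ (b i) (w : V) ^ 2 * inner ℝ (b j) (w : V) ^ 2) (volume : Measure V).toSphere :=
      integrable_toSphere (G := fun w => inner ℝ (b i) w ^ 2 * inner ℝ (b j) w ^ 2) (by fun_prop)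
    simp_rw [← integral_finsetSum Finset.univ (fun j _ => hi _ j)]
    rw [← integral_finsetSum _ (fun i _ => integrable_finsetSum _ fun j _ => hi i j)]
    simp_rw [sum_inner_sq_mul_inner_sq b]
    rw [integral_const, toSphere_real_univ, smul_eq_mul, mul_one]
  have hm' : m = 4 * Real.pi / 5 := by
    simp [Fin.sum_univ_three] at hsum
    linarith
  rw [hij, hm']
  split_ifs <;> ring

/-- Inserting the factor `|w|² = 1` reduces this to the fourth moments. -/
theorem integral_inner_sq_basis (b : OrthonormalBasis (Fin 3) ℝ V) (i : Fin 3) :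
    ∫ w : sphere (0 : V) 1, inner ℝ (b i) (w : V) ^ 2 ∂(volume : Measure V).toSphere
      = 4 * Real.pi / 3 := by
  have key : ∫ w : sphere (0 : V) 1, inner ℝ (b i) (w : V) ^ 2 ∂(volume : Measure V).toSphere
      = ∫ w : sphere (0 : V) 1, ∑ j, inner ℝ (b i) (w : V) ^ 2 * inner ℝ (b j) (w : V) ^ 2
        ∂(volume : Measure V).toSphere := by
    congr with w
    have := b.sum_sq_norm_inner_right (w : V)
    rw [← Finset.mul_sum, show ∑ j, inner ℝ (b j) (w : V) ^ 2 = 1 by simpa using this, mul_one]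
  rw [key, integral_finsetSum _ fun j _ => integrable_toSphere
    (G := fun w => inner ℝ (b i) w ^ 2 * inner ℝ (b j) w ^ 2) (by fun_prop)]
  simp_rw [integral_inner_sq_mul_inner_sq_basis]
  fin_cases i <;> simp [Fin.sum_univ_three] <;> ring

theorem sum_inner_operator_eq {V : Type*} [NormedAddCommGroup V] [InnerProductSpace ℝ V]
    (T : V →ₗ[ℝ] V) (e b : OrthonormalBasis (Fin 3) ℝ V) :
    ∑ i, inner ℝ (T (e i)) (e i) = ∑ i, inner ℝ (T (b i)) (b i) := by
  have h (e : OrthonormalBasis (Fin 3) ℝ V) :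
      ∑ i, inner ℝ (T (e i)) (e i) = ∑ i, inner ℝ (e i) (T (e i)) :=
    Finset.sum_congr rfl fun i _ => real_inner_comm _ _
  rw [h, h, ← LinearMap.trace_eq_sum_inner T e, LinearMap.trace_eq_sum_inner T b]

theorem sum_inner_operator_operator_eq {V : Type*} [NormedAddCommGroup V]
    [InnerProductSpace ℝ V] {T : V →ₗ[ℝ] V} (hT : T.IsSymmetric)
    (e b : OrthonormalBasis (Fin 3) ℝ V) :
    ∑ i, inner ℝ (T (e i)) (T (e i)) = ∑ i, inner ℝ (T (b i)) (T (b i)) := by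
  have h (v : V) : inner ℝ (T v) (T v) = inner ℝ ((T ∘ₗ T) v) v := by
    rw [LinearMap.comp_apply, hT (T v) v]
  simp_rw [h]
  exact sum_inner_operator_eq (T ∘ₗ T) e b

/-- The mean values over the unit sphere of the quadratic form of a symmetric operator, of its
square, and of the squared norm of the operator. -/
theorem integral_symmetric_operator {T : V →ₗ[ℝ] V} (hT : T.IsSymmetric)
    (e : OrthonormalBasis (Fin 3) ℝ V) :
    ∫ w : sphere (0 : V) 1, inner ℝ (T w) (w : V) ∂(volume : Measure V).toSphere
        = 4 * Real.pi / 3 * ∑ i, inner ℝ (T (e i)) (e i) ∧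
    ∫ w : sphere (0 : V) 1, inner ℝ (T w) (w : V) ^ 2 ∂(volume : Measure V).toSphere
        = 4 * Real.pi / 15 * ((∑ i, inner ℝ (T (e i)) (e i)) ^ 2
            + 2 * ∑ i, inner ℝ (T (e i)) (T (e i))) ∧
    ∫ w : sphere (0 : V) 1, inner ℝ (T w) (T w) ∂(volume : Measure V).toSphere
        = 4 * Real.pi / 3 * ∑ i, inner ℝ (T (e i)) (T (e i)) := by
  have h3 : Module.finrank ℝ V = 3 := Fact.out
  -- In an eigenbasis all three integrands are polynomials in the squared coordinates of `w`; both
  -- traces are independent of the basis.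
  let b := hT.eigenvectorBasis h3
  let l := hT.eigenvalues h3
  have hb (i : Fin 3) : T (b i) = l i • b i := hT.apply_eigenvectorBasis h3 i
  have hTb (w : V) (i : Fin 3) : inner ℝ (b i) (T w) = l i * inner ℝ (b i) w := by
    rw [← hT, hb, real_inner_smul_left]
  have hS : ∑ i, inner ℝ (T (e i)) (e i) = ∑ i, l i := by
    rw [sum_inner_operator_eq T e b]
    simp [hb, real_inner_smul_left]
  have hQ : ∑ i, inner ℝ (T (e i)) (T (e i)) = ∑ i, l i ^ 2 := by
    rw [sum_inner_operator_operator_eq hT e b]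
    refine Finset.sum_congr rfl fun i _ => ?_
    rw [hb, real_inner_smul_left, real_inner_smul_right, real_inner_self_eq_norm_sq,
      b.norm_eq_one]
    ring
  have h1 (w : V) : inner ℝ (T w) w = ∑ i, l i * inner ℝ (b i) w ^ 2 := by
    rw [← b.sum_inner_mul_inner]
    refine Finset.sum_congr rfl fun i _ => ?_
    rw [real_inner_comm, hTb]
    ring
  have h2 (w : V) : inner ℝ (T w) (T w) = ∑ i, l i ^ 2 * inner ℝ (b i) w ^ 2 := by
    rw [← b.sum_inner_mul_inner]
    refine Finset.sum_congr rfl fun i _ => ?_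
    rw [real_inner_comm, hTb]
    ring
  have hlin (c : Fin 3 → ℝ) : ∫ w : sphere (0 : V) 1, ∑ i, c i * inner ℝ (b i) (w : V) ^ 2
      ∂(volume : Measure V).toSphere = 4 * Real.pi / 3 * ∑ i, c i := by
    rw [integral_finsetSum _ fun i _ => integrable_toSphere
      (G := fun w => c i * inner ℝ (b i) w ^ 2) (by fun_prop)]
    simp_rw [integral_const_mul, integral_inner_sq_basis, Finset.mul_sum, mul_comm]
  refine ⟨?_, ?_, ?_⟩
  · rw [hS]
    simp_rw [h1, hlin]
  · rw [hS, hQ]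
    simp_rw [h1]
    have hsq (w : V) : (∑ i, l i * inner ℝ (b i) w ^ 2) ^ 2
        = ∑ i, ∑ j, l i * l j * (inner ℝ (b i) w ^ 2 * inner ℝ (b j) w ^ 2) := by
      rw [sq, Finset.sum_mul_sum]
      refine Finset.sum_congr rfl fun i _ => Finset.sum_congr rfl fun j _ => by ring
    have hi (i j : Fin 3) : Integrable (fun w : sphere (0 : V) 1 =>
        l i * l j * (inner ℝ (b i) (w : V) ^ 2 * inner ℝ (b j) (w : V) ^ 2))
        (volume : Measure V).toSphere :=
      integrable_toSphere
        (G := fun w => l i * l j * (inner ℝ (b i) w ^ 2 * inner ℝ (b j) w ^ 2)) (by fun_prop)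
    simp_rw [hsq]
    rw [integral_finsetSum _ fun i _ => integrable_finsetSum _ fun j _ => hi i j]
    simp_rw [integral_finsetSum Finset.univ (fun j _ => hi _ j), integral_const_mul,
      integral_inner_sq_mul_inner_sq_basis]
    simp [Fin.sum_univ_three]
    ring
  · rw [hQ]
    simp_rw [h2, hlin]

/-- Integration of a function times `α₂` over the sphere of radius `s`, reduced to the
unit sphere. -/
theorem sphereIntegral_smul_alpha2 (o : Orientation ℝ V (Fin 3)) {s : ℝ} (hs : 0 < s)
    {f G : V → ℝ} (hG : Continuous G) (hfG : ∀ w : V, ‖w‖ = 1 → f (s • w) = G w) :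
    SphereIntegrable o s (fun u => f u • alpha2 o s u) ∧
      1 / s ^ 2 * sphereIntegral o s (fun u => f u • alpha2 o s u)
        = ∫ w : sphere (0 : V) 1, G w ∂(volume : Measure V).toSphere := by
  -- At `u = s e₀` the form `α₂` takes the value `s⁻¹ vol(s e₀, e₁, e₂) = 1` on `(e₁, e₂)`. The
  -- factor `s²` in the area measure later cancels `1/s²`.
  have hdens (w : sphere (0 : V) 1) :
      sphereDensity o (fun u => f u • alpha2 o s u) (s • (w : V)) = G w := by
    have hw : ‖(w : V)‖ = 1 := by simp
    have hu : s • (w : V) ≠ 0 := by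
      simp [hs.ne', ← norm_ne_zero_iff, hw]
    have ha := adaptedFrame_spec o hu
    have h0 : s • (w : V) = s • adaptedFrame o (s • (w : V)) 0 := by
      rw [ha.zero_eq, norm_smul, hw, mul_one, Real.norm_of_nonneg hs.le, smul_smul,
        smul_smul, mul_inv_cancel₀ hs.ne', one_mul]
    have hvol : o.volumeForm (adaptedFrame o (s • (w : V))) = 1 := by
      have h3 : Module.finrank ℝ V = 3 := Fact.out
      let b := (basisOfOrthonormalOfCardEqFinrank ha.orthonormal (by simp [h3])).toOrthonormalBasis
        (by simpa using ha.orthonormal)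
      have hb : ⇑b = adaptedFrame o (s • (w : V)) := by simp [b]
      have := o.abs_volumeForm_apply_of_orthonormal b
      rwa [hb, abs_of_pos ha.positive] at this
    have hcons (v : Fin 3 → V) : Matrix.vecCons (s • v 0) ![v 1, v 2]
        = Function.update v 0 (s • v 0) := by
      ext i
      fin_cases i <;> simp
    rw [sphereDensity, AlternatingMap.smul_apply, alpha2, AlternatingMap.smul_apply,
      AlternatingMap.curryLeft_apply_apply]
    nth_rw 2 [h0]
    rw [hcons, AlternatingMap.map_update_smul, Function.update_eq_self, hvol, hfG _ hw]
    simp [hs.ne']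
  have hemb : MeasurableEmbedding (fun w : sphere (0 : V) 1 => s • (w : V)) :=
    (Homeomorph.smulOfNeZero s hs.ne').measurableEmbedding.comp
      (MeasurableEmbedding.subtype_coe isClosed_sphere.measurableSet)
  constructor
  · rw [SphereIntegrable, sphereArea]
    refine Integrable.smul_measure ?_ ENNReal.ofReal_ne_top
    rw [hemb.integrable_map_iff]
    refine (integrable_toSphere hG).congr (Filter.Eventually.of_forall fun w => ?_)
    exact (hdens w).symm
  · rw [sphereIntegral, sphereArea, integral_smul_measure, hemb.integral_map,
      ENNReal.toReal_ofReal (by positivity)]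
    simp_rw [hdens]
    rw [smul_eq_mul, ← mul_assoc, one_div, inv_mul_cancel₀ (by positivity), one_mul]

end Sphere

/-! ### Algebraic curvature tensors in dimension three. -/

section AlgebraicCurvature

variable {V : Type*} [NormedAddCommGroup V] [InnerProductSpace ℝ V]

/-- `R` is trilinear and has the symmetries of a Riemannian curvature tensor. -/
structure IsAlgebraicCurvature (R : V → V → V → V) : Prop where
  add_left (v v' w z : V) : R (v + v') w z = R v w z + R v' w z
  smul_left (a : ℝ) (v w z : V) : R (a • v) w z = a • R v w z
  add_right (v w z z' : V) : R v w (z + z') = R v w z + R v w z'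
  smul_right (a : ℝ) (v w z : V) : R v w (a • z) = a • R v w z
  swap (v w z : V) : R v w z = -R w v z
  bianchi (v w z : V) : R v w z + R w z v + R z v w = 0
  inner_self (v w z : V) : inner ℝ (R v w z) z = 0

namespace IsAlgebraicCurvature

variable {R : V → V → V → V} (hR : IsAlgebraicCurvature R)
include hR

theorem inner_swap (v w y z : V) : inner ℝ (R v w z) y = -inner ℝ (R v w y) z := by
  have h := hR.inner_self v w (y + z)
  rw [hR.add_right, inner_add_left, inner_add_right, inner_add_right, hR.inner_self,
    hR.inner_self] at h
  linarith

theorem pair_symm (v w z y : V) : inner ℝ (R v w z) y = inner ℝ (R y z w) v := by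
  -- The classical octahedron argument: four Bianchi identities combined with the two
  -- skew-symmetries.
  have b (v w z y : V) :
      inner ℝ (R v w z) y + inner ℝ (R w z v) y + inner ℝ (R z v w) y = 0 := by
    rw [← inner_add_left, ← inner_add_left, hR.bianchi, inner_zero_left]
  have s (v w z y : V) : inner ℝ (R v w z) y = -inner ℝ (R w v z) y := by
    rw [hR.swap, inner_neg_left]
  have t := hR.inner_swap
  linarith [b v w z y, b w z y v, b z y v w, b y v w z, s v w z y, s w z v y, s z v w y,
    s y z w v, s w y z v, s z y w v, s v y z w, s y v w z, t v w y z, t w z v y, t z v w y,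
    t y z w v, t w y z v, t v y z w, t v z w y, t y v w z, t w v y z, t z w v y, t z y w v, t z y v w,
    s v z w y, s z w v y, s w z y v, s z w y v, s y w z v, s v z y w, s z v y w]

/-- The curvature as a trilinear map. -/
theorem exists_linear :
    ∃ L : V →ₗ[ℝ] V →ₗ[ℝ] V →ₗ[ℝ] V, ∀ v w z, L v w z = R v w z := by
  refine ⟨LinearMap.mk₂ ℝ (fun v w => ⟨⟨fun z => R v w z, hR.add_right v w⟩,
    fun a z => hR.smul_right a v w z⟩) ?_ ?_ ?_ ?_, fun v w z => rfl⟩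
  · intro v v' w
    ext z
    exact hR.add_left v v' w z
  · intro a v w
    ext z
    exact hR.smul_left a v w z
  · intro v w w'
    ext z
    change R v (w + w') z = R v w z + R v w' z
    rw [hR.swap, hR.add_left, neg_add, ← hR.swap, ← hR.swap]
  · intro a v w
    ext z
    change R v (a • w) z = a • R v w z
    rw [hR.swap, hR.smul_left, ← smul_neg, ← hR.swap]

end IsAlgebraicCurvature

/-- A metric contraction is independent of the orthonormal basis. Values in a general `W` are
allowed because the Ricci operator contracts a vector-valued form. -/
theorem sum_bilinear_orthonormalBasis {W : Type*} [AddCommGroup W] [Module ℝ W]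
    (B : V →ₗ[ℝ] V →ₗ[ℝ] W) (b e : OrthonormalBasis (Fin 3) ℝ V) :
    ∑ a, B (e a) (e a) = ∑ a, B (b a) (b a) := by
  have h (a : Fin 3) : B (e a) (e a)
      = ∑ i, ∑ j, (inner ℝ (b i) (e a) * inner ℝ (e a) (b j)) • B (b i) (b j) := by
    conv_lhs => rw [← b.sum_repr' (e a)]
    simp only [map_sum, map_smul, LinearMap.sum_apply, LinearMap.smul_apply, Finset.smul_sum,
      smul_smul]
    rw [Finset.sum_comm]
    refine Finset.sum_congr rfl fun i _ => Finset.sum_congr rfl fun j _ => ?_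
    rw [real_inner_comm (b j), mul_comm]
  simp_rw [h]
  rw [Finset.sum_comm]
  refine Finset.sum_congr rfl fun i _ => ?_
  rw [Finset.sum_comm]
  simp_rw [← Finset.sum_smul, e.sum_inner_mul_inner, b.inner_eq_ite]
  simp

/-- Existence of the Ricci operator. -/
theorem IsAlgebraicCurvature.exists_ricci {R : V → V → V → V} (hR : IsAlgebraicCurvature R)
    (b : OrthonormalBasis (Fin 3) ℝ V) :
    ∃ T : V →ₗ[ℝ] V, T.IsSymmetric ∧
      ∀ (e : OrthonormalBasis (Fin 3) ℝ V) (v : V), T v = ∑ a, R v (e a) (e a) := by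
  obtain ⟨L, hL⟩ := hR.exists_linear
  have hT (v : V) : (∑ a, (L.flip (b a)).flip (b a)) v = ∑ a, R v (b a) (b a) := by
    simp [LinearMap.sum_apply, hL]
  refine ⟨∑ a, (L.flip (b a)).flip (b a), fun v w => ?_, fun e v => ?_⟩
  · rw [hT, hT, sum_inner, inner_sum]
    refine Finset.sum_congr rfl fun a _ => ?_
    rw [hR.pair_symm, real_inner_comm]
  · rw [hT]
    simp_rw [← hL]
    exact (sum_bilinear_orthonormalBasis (L v) b e).symm

theorem sum_sq_of_antisymm {g : Fin 3 → Fin 3 → ℝ} (hg : ∀ i j, g i j = -g j i) :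
    ∑ i, ∑ j, g i j ^ 2 = 2 * (g 0 1 ^ 2 + g 0 2 ^ 2 + g 1 2 ^ 2) := by
  have h (i : Fin 3) : g i i = 0 := by linarith [hg i i]
  simp only [Fin.sum_univ_three, h, hg 1 0, hg 2 0, hg 2 1]
  ring

/-- In dimension three the curvature tensor is determined by the Ricci operator `T`. -/
theorem IsAlgebraicCurvature.components {R : V → V → V → V} (hR : IsAlgebraicCurvature R)
    {T : V →ₗ[ℝ] V} (e : OrthonormalBasis (Fin 3) ℝ V)
    (hT : ∀ v, T v = ∑ a, R v (e a) (e a)) {C : Fin 3 → Fin 3 → Fin 3 → Fin 3 → ℝ}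
    (hC : ∀ l k i j, C l k i j = inner ℝ (R (e i) (e j) (e k)) (e l)) {S Q : ℝ}
    (hS : ∑ i, inner ℝ (T (e i)) (e i) = S) (hQ : ∑ i, inner ℝ (T (e i)) (T (e i)) = Q) :
    ∑ a, ∑ b, C a b a b = S ∧
    ∑ a, ∑ b, ∑ c, ∑ d, C a b c d ^ 2 = 4 * Q - S ^ 2 ∧
    C 1 2 1 2 = S / 2 - inner ℝ (T (e 0)) (e 0) ∧
    C 1 0 1 0 + C 2 0 2 0 = inner ℝ (T (e 0)) (e 0) ∧
    C 1 0 1 2 ^ 2 + C 2 0 1 2 ^ 2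
      = inner ℝ (T (e 0)) (T (e 0)) - inner ℝ (T (e 0)) (e 0) ^ 2 ∧
    2 * C 1 0 0 2 ^ 2 + 1 / 2 * (C 1 0 0 1 - C 2 0 0 2) ^ 2
      = Q - 2 * inner ℝ (T (e 0)) (T (e 0)) + inner ℝ (T (e 0)) (e 0) ^ 2
        - 1 / 2 * (S - inner ℝ (T (e 0)) (e 0)) ^ 2 := by
  have h1 (l k i j : Fin 3) : C l k i j = -C k l i j := by
    rw [hC, hC, hR.inner_swap]
  have h2 (l k i j : Fin 3) : C l k i j = -C l k j i := by
    rw [hC, hC, hR.swap, inner_neg_left]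
  have h3 (l k i j : Fin 3) : C l k i j = C i j l k := by
    rw [hC, hC, hR.pair_symm]
  have z1 (l i j : Fin 3) : C l l i j = 0 := by linarith [h1 l l i j]
  have z2 (l k i : Fin 3) : C l k i i = 0 := by linarith [h2 l k i i]
  have hric (i j : Fin 3) : inner ℝ (T (e i)) (e j) = ∑ a, C j a i a := by
    rw [hT, sum_inner]
    simp_rw [hC]
  have hnorm (i : Fin 3) : inner ℝ (T (e i)) (T (e i)) = ∑ j, (∑ a, C j a i a) ^ 2 := by
    rw [← e.sum_inner_mul_inner]
    refine Finset.sum_congr rfl fun j _ => ?_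
    rw [real_inner_comm (T (e i)) (e j), hric]
    ring
  simp_rw [hric] at hS
  simp_rw [hnorm] at hQ
  have hN : ∑ a, ∑ b, ∑ c, ∑ d, C a b c d ^ 2
      = 4 * (C 0 1 0 1 ^ 2 + C 0 2 0 2 ^ 2 + C 1 2 1 2 ^ 2 + 2 * C 0 1 0 2 ^ 2
        + 2 * C 0 1 1 2 ^ 2 + 2 * C 0 2 1 2 ^ 2) := by
    simp_rw [sum_sq_of_antisymm (h2 _ _), ← Finset.mul_sum, Finset.sum_add_distrib]
    rw [sum_sq_of_antisymm (g := fun a b => C a b 0 1) (fun a b => h1 a b 0 1),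
      sum_sq_of_antisymm (g := fun a b => C a b 0 2) (fun a b => h1 a b 0 2),
      sum_sq_of_antisymm (g := fun a b => C a b 1 2) (fun a b => h1 a b 1 2),
      h3 0 2 0 1, h3 1 2 0 1, h3 1 2 0 2]
    ring
  rw [hN, hnorm, hric]
  -- These rewrites move every index pair to `01`, `02` or `12`. Pair symmetry leaves six
  -- independent components, and all the claims become polynomial identities in them.
  have e1 := h1 1 0
  have e2 := h1 2 0
  have e3 := h1 2 1
  have f1 (l k : Fin 3) := h2 l k 1 0
  have f2 (l k : Fin 3) := h2 l k 2 0
  have f3 (l k : Fin 3) := h2 l k 2 1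
  have g1 := h3 0 2 0 1
  have g2 := h3 1 2 0 1
  have g3 := h3 1 2 0 2
  simp only [Fin.sum_univ_three, z1, z2, e1, e2, e3, f1, f2, f3, g1, g2, g3] at hS hQ ⊢
  subst hS hQ
  refine ⟨?_, ?_, ?_, ?_, ?_, ?_⟩ <;> ring

end AlgebraicCurvature

/-! ### The Levi-Civita curvature at a point. -/

section LeviCivita

variable {M : Type*} [TopologicalSpace M] [T2Space M] [ChartedSpace E3 M]
  [IsManifold (𝓡 3) ∞ M] [RiemannianBundle (fun x : M => TangentSpace (𝓡 3) x)]
  [IsContMDiffRiemannianBundle (𝓡 3) ∞ E3 (fun x : M => TangentSpace (𝓡 3) x)]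
  {cov : CovariantDerivative (𝓡 3) E3 (fun x : M => TangentSpace (𝓡 3) x)}

theorem IsLeviCivita.isAlgebraicCurvature (hcov : IsLeviCivita cov) (x : M) :
    IsAlgebraicCurvature (fun v w z : TangentSpace (𝓡 3) x => curvature cov v w z) where
  add_left v v' w z := by
    have h := curv_congr hcov.smooth (smoothNear_extend (v + v')) (smoothNear_extend w)
      (smoothNear_extend z) (extend_add v v') (.of_forall fun _ => rfl) (.of_forall fun _ => rfl)
    exact h.trans (curv_add_left hcov.smooth (smoothNear_extend v) (smoothNear_extend v')
      (smoothNear_extend z))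
  smul_left a v w z := by
    have h := curv_congr hcov.smooth (smoothNear_extend (a • v)) (smoothNear_extend w)
      (smoothNear_extend z) (extend_smul a v) (.of_forall fun _ => rfl) (.of_forall fun _ => rfl)
    exact h.trans (curv_smul_left hcov.smooth a (smoothNear_extend v) (smoothNear_extend z))
  add_right v w z z' := by
    have h := curv_congr hcov.smooth (smoothNear_extend v) (smoothNear_extend w)
      (smoothNear_extend (z + z')) (.of_forall fun _ => rfl) (.of_forall fun _ => rfl)
      (extend_add z z')
    exact h.trans (curv_add_right hcov.smooth (smoothNear_extend v) (smoothNear_extend w)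
      (smoothNear_extend z) (smoothNear_extend z'))
  smul_right a v w z := by
    have h := curv_congr hcov.smooth (smoothNear_extend v) (smoothNear_extend w)
      (smoothNear_extend (a • z)) (.of_forall fun _ => rfl) (.of_forall fun _ => rfl)
      (extend_smul a z)
    exact h.trans (curv_smul_right hcov.smooth a (smoothNear_extend v) (smoothNear_extend w)
      (smoothNear_extend z))
  swap v w z := curv_swap
  bianchi v w z := curv_bianchi hcov.smooth hcov.torsion_free (smoothNear_extend v)
    (smoothNear_extend w) (smoothNear_extend z)
  inner_self v w z := by
    have h := inner_curv_self hcov.smooth hcov.metric (smoothNear_extend v)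
      (smoothNear_extend w) (smoothNear_extend z)
    rwa [FiberBundle.extend_apply_self] at h

end LeviCivita

/-! ### Adapted frames as orthonormal bases. -/

section Adapted

variable {V : Type*} [NormedAddCommGroup V] [InnerProductSpace ℝ V]
  [Fact (Module.finrank ℝ V = 3)]

theorem IsAdapted.exists_orthonormalBasis {o : Orientation ℝ V (Fin 3)} {u : V} {e : Fin 3 → V}
    (he : IsAdapted o u e) : ∃ b : OrthonormalBasis (Fin 3) ℝ V, ⇑b = e := by
  have h3 : Module.finrank ℝ V = 3 := Fact.out
  have hspan := (basisOfLinearIndependentOfCardEqFinrank he.orthonormal.linearIndependent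
    (by simp [h3])).span_eq
  refine ⟨OrthonormalBasis.mk he.orthonormal (by simpa using hspan.ge), by simp⟩

end Adapted

end TangentSphere

end

theorem mainTheorem6 {M : Type*} [TopologicalSpace M] [T2Space M]
    [ChartedSpace TangentSphere.E3 M] [IsManifold (𝓡 3) ∞ M]
    [RiemannianBundle (fun x : M => TangentSpace (𝓡 3) x)]
    [IsContMDiffRiemannianBundle (𝓡 3) ∞ TangentSphere.E3
      (fun x : M => TangentSpace (𝓡 3) x)]
    (o : TangentSphere.ManifoldOrientation M)
    (cov : CovariantDerivative (𝓡 3) TangentSphere.E3 (fun x : M => TangentSpace (𝓡 3) x))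
    (hcov : TangentSphere.IsLeviCivita cov)
    (s : ℝ) (hs : 0 < s) (x : M)
    -- any orthonormal frame at `x`, used for the scalar curvature and the norm of `R`
    (b : OrthonormalBasis (Fin 3) ℝ (TangentSpace (𝓡 3) x))
    -- any choice of adapted frames at the points `u` of the fibre over `x`
    (e : TangentSpace (𝓡 3) x → Fin 3 → TangentSpace (𝓡 3) x)
    (he : ∀ u : TangentSpace (𝓡 3) x, ‖u‖ = s → TangentSphere.IsAdapted (o.at' x) u (e u)) :
    let S : ℝ := TangentSphere.scal cov b
    let N : ℝ := TangentSphere.normSqR cov b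
    TangentSphere.HasFibreIntegral o s x (fun _ => 1) (4 * Real.pi) ∧
    TangentSphere.HasFibreIntegral o s x (fun u => TangentSphere.cFun cov (e u))
      (2 * Real.pi / 3 * S) ∧
    TangentSphere.HasFibreIntegral o s x (fun u => TangentSphere.cFun cov (e u) ^ 2)
      (Real.pi / 15 * (2 * N + S ^ 2)) ∧
    TangentSphere.HasFibreIntegral o s x (fun u => TangentSphere.rFun cov (e u))
      (4 * Real.pi / 3 * S) ∧
    TangentSphere.HasFibreIntegral o s x (fun u => TangentSphere.rFun cov (e u) ^ 2)
      (2 * Real.pi / 15 * (N + 3 * S ^ 2)) ∧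
    TangentSphere.HasFibreIntegral o s x (fun u => TangentSphere.pSq cov (e u))
      (Real.pi / 15 * (3 * N - S ^ 2)) ∧
    TangentSphere.HasFibreIntegral o s x (fun u => TangentSphere.qSq cov (e u))
      (2 * Real.pi / 15 * (3 * N - S ^ 2)) := by

  intro S N
  have hR := hcov.isAlgebraicCurvature x
  obtain ⟨T, hsymm, hT⟩ := hR.exists_ricci b
  obtain ⟨hS, hN, -⟩ := hR.components b (hT b) (C := TangentSphere.Rm cov b)
    (fun _ _ _ _ => rfl) rfl rfl
  obtain ⟨hI1, hI2, hI3⟩ := TangentSphere.integral_symmetric_operator hsymm b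
  set Q := ∑ i, inner ℝ (T (b i)) (T (b i)) with hQdef
  have hS' : S = ∑ i, inner ℝ (T (b i)) (b i) := hS
  have hN' : N = 4 * Q - S ^ 2 := by
    rw [hS']
    exact hN
  rw [← hS'] at hI1 hI2
  have hTc : Continuous T := T.continuous_of_finiteDimensional
  have hcomp (w : TangentSpace (𝓡 3) x) (hw : ‖w‖ = 1) :
      TangentSphere.cFun cov (e (s • w)) = S / 2 - inner ℝ (T w) w ∧
      TangentSphere.rFun cov (e (s • w)) = inner ℝ (T w) w ∧
      TangentSphere.pSq cov (e (s • w)) = inner ℝ (T w) (T w) - inner ℝ (T w) w ^ 2 ∧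
      TangentSphere.qSq cov (e (s • w))
        = Q - 2 * inner ℝ (T w) (T w) + inner ℝ (T w) w ^ 2
          - 1 / 2 * (S - inner ℝ (T w) w) ^ 2 := by
    have hnorm : ‖s • w‖ = s := by rw [norm_smul, hw, mul_one, Real.norm_of_nonneg hs.le]
    have ha := he (s • w) hnorm
    obtain ⟨f, hf⟩ := ha.exists_orthonormalBasis
    have hf0 : f 0 = w := by
      rw [hf, ha.zero_eq, hnorm, smul_smul, inv_mul_cancel₀ hs.ne', one_smul]
    -- The frame `f` varies with `w`, but the two traces agree with those in the fixed frame `b`.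
    have htr1 : ∑ i, inner ℝ (T (f i)) (f i) = S := by
      rw [hS']
      exact TangentSphere.sum_inner_operator_eq T f b
    have htr2 : ∑ i, inner ℝ (T (f i)) (T (f i)) = Q :=
      TangentSphere.sum_inner_operator_operator_eq hsymm f b
    obtain ⟨-, -, h1, h2, h3, h4⟩ := hR.components f (hT f) (C := TangentSphere.Rm cov f)
      (fun _ _ _ _ => rfl) htr1 htr2
    rw [hf0, hf] at h1 h2 h3 h4
    exact ⟨h1, h2, h3, h4⟩
  have hi1 := TangentSphere.integrable_toSphere
    (G := fun w : TangentSpace (𝓡 3) x => inner ℝ (T w) w) (by fun_prop)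
  have hi2 := TangentSphere.integrable_toSphere
    (G := fun w : TangentSpace (𝓡 3) x => inner ℝ (T w) w ^ 2) (by fun_prop)
  have hi3 := TangentSphere.integrable_toSphere
    (G := fun w : TangentSpace (𝓡 3) x => inner ℝ (T w) (T w)) (by fun_prop)
  have comb (k a₁ a₂ a₃ : ℝ) :
      ∫ w : sphere (0 : TangentSpace (𝓡 3) x) 1,
        (k + a₁ * inner ℝ (T w) w + (a₂ * inner ℝ (T w) w ^ 2 + a₃ * inner ℝ (T w) (T w)))
        ∂(volume : Measure (TangentSpace (𝓡 3) x)).toSphere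
      = k * (4 * Real.pi) + a₁ * (4 * Real.pi / 3 * S)
        + (a₂ * (4 * Real.pi / 15 * (S ^ 2 + 2 * Q)) + a₃ * (4 * Real.pi / 3 * Q)) := by
    rw [integral_add (by exact (integrable_const k).add (hi1.const_mul a₁))
        (by exact (hi2.const_mul a₂).add (hi3.const_mul a₃)),
      integral_add (integrable_const k) (hi1.const_mul a₁),
      integral_add (hi2.const_mul a₂) (hi3.const_mul a₃), integral_const_mul, integral_const_mul,
      integral_const_mul, hI1, hI2, hI3, integral_const, TangentSphere.toSphere_real_univ,
      smul_eq_mul, mul_comm k]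
  have main {f : TangentSpace (𝓡 3) x → ℝ} {a : ℝ} (k a₁ a₂ a₃ : ℝ)
      (hf : ∀ w, ‖w‖ = 1 → f (s • w)
        = k + a₁ * inner ℝ (T w) w + (a₂ * inner ℝ (T w) w ^ 2 + a₃ * inner ℝ (T w) (T w)))
      (ha : k * (4 * Real.pi) + a₁ * (4 * Real.pi / 3 * S)
        + (a₂ * (4 * Real.pi / 15 * (S ^ 2 + 2 * Q)) + a₃ * (4 * Real.pi / 3 * Q)) = a) :
      TangentSphere.HasFibreIntegral o s x f a := by
    have h := TangentSphere.sphereIntegral_smul_alpha2 (o.at' x) hs (f := f) (by fun_prop) hf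
    exact ⟨h.1, h.2.trans ((comb k a₁ a₂ a₃).trans ha)⟩
  -- The four numbers are the coefficients of `1`, `⟨Tw,w⟩`, `⟨Tw,w⟩²` and `|Tw|²` in the expanded
  -- formulas of `hcomp`.
  refine ⟨main 1 0 0 0 ?_ ?_, main (S / 2) (-1) 0 0 ?_ ?_, main (S ^ 2 / 4) (-S) 1 0 ?_ ?_,
    main 0 1 0 0 ?_ ?_, main 0 0 1 0 ?_ ?_, main 0 0 (-1) 1 ?_ ?_,
    main (Q - 1 / 2 * S ^ 2) S (1 / 2) (-2) ?_ ?_⟩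
  · intro w _
    ring
  · ring
  · intro w hw
    rw [(hcomp w hw).1]
    ring
  · ring
  · intro w hw
    rw [(hcomp w hw).1]
    ring
  · rw [hN']
    ring
  · intro w hw
    rw [(hcomp w hw).2.1]
    ring
  · ring
  · intro w hw
    rw [(hcomp w hw).2.1]
    ring
  · rw [hN']
    ring
  · intro w hw
    rw [(hcomp w hw).2.2.1]
    ring
  · rw [hN']
    ring
  · intro w hw
    rw [(hcomp w hw).2.2.2]
    ring
  · rw [hN']
    ring
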